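/- Let $K=\mathbb{R}$ or $K=\mathbb{C}$ and let $\mathbb{P}^d$ be projective $d$-space over $K$. A camera is a linear rational map $A:\mathbb{P}^3\dashrightarrow\mathbb{P}^2$ given by a $3\times 4$ matrix of rank three; its center is the unique point $a\in\mathbb{P}^3$ with $Aa=0$. For ordered $n$-tuples $\mathcal{X}=(x_1,\dots,x_n)$, $\mathcal{Y}=(y_1,\dots,y_n)$ of points of $\mathbb{P}^3$ and cameras $A,B$, write $(Ax_i)_{i=1}^n\sim(By_i)_{i=1}^n$ if no $x_i$ is the center of $A$, no $y_i$ is the center of $B$, and there is $H\in\mathrm{SL}(3,K)$ with $Ax_i=HBy_i$ in $\mathbb{P}^2$ for all $i$. The centers-variety of $(\mathcal{X},\mathcal{Y})$ is the Zariski closure in $\mathbb{P}^3\times\mathbb{P}^3$ of the set of pairs $(a,b)$ of centers of cameras $A,B$ with $(Ax_i)_{i=1}^n\sim(By_i)_{i=1}^n$. Corollary. Let $n\ge 8$. For two generic ordered $n$-tuples $\mathcal{X},\mathcal{Y}$ of points of $\mathbb{P}^3$, that is, for all $(\mathcal{X},\mathcal{Y})$ in some nonempty Zariski-open subset of $(\mathbb{P}^3)^n\times(\mathbb{P}^3)^n$,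 there are no two cameras $A,B$ such that $(Ax_i)_{i=1}^n\sim(By_i)_{i=1}^n$. In other words, the centers-variety of $(\mathcal{X},\mathcal{Y})$ is empty. -/

import Mathlib

open scoped LinearAlgebra.Projectivization

/-- The projective space `ℙ³` over `K`. -/
abbrev P3 (K : Type*) [Field K] := ℙ K (Fin 4 → K)

/-- The projective plane `ℙ²` over `K`. -/
abbrev P2 (K : Type*) [Field K] := ℙ K (Fin 3 → K)

section Zariski

/-! ### The Zariski topology on a product `(ℙ³)^ι` -/

variable {K : Type*} [Field K] {ι : Type*} [DecidableEq ι]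

/-- A polynomial in the variables `x_{i,0}, …, x_{i,3}` (`i : ι`) is multihomogeneous of
multidegree `d` if each of its monomials has degree `d i` in `x_{i,0}, …, x_{i,3}`, for every
`i`. -/
def IsMultihomogeneous (F : MvPolynomial (ι × Fin 4) K) (d : ι → ℕ) : Prop :=
  MvPolynomial.IsWeightedHomogeneous (fun p : ι × Fin 4 => (Pi.single p.1 1 : ι → ℕ)) F d

/-- Vanishing of `F` at a point of `(ℙ³)^ι`, tested on the chosen homogeneous coordinates. For a
multihomogeneous `F` the choice does not matter, see `vanishesAt_iff`. -/
def VanishesAt (F : MvPolynomial (ι × Fin 4) K) (P : ι → P3 K) : Prop :=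
  MvPolynomial.eval (fun p : ι × Fin 4 => (P p.1).rep p.2) F = 0

theorem eval_smul_of_isMultihomogeneous [Fintype ι] {F : MvPolynomial (ι × Fin 4) K}
    {d : ι → ℕ} (hF : IsMultihomogeneous F d) (c : ι → K) (v : ι → Fin 4 → K) :
    MvPolynomial.eval (fun p : ι × Fin 4 => c p.1 * v p.1 p.2) F =
      (∏ i, c i ^ d i) * MvPolynomial.eval (fun p : ι × Fin 4 => v p.1 p.2) F := by
  rw [MvPolynomial.eval_eq', MvPolynomial.eval_eq', Finset.mul_sum]
  refine Finset.sum_congr rfl fun m hm => ?_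
  have h := hF (MvPolynomial.mem_support_iff.mp hm)
  have hd : ∀ i, d i = ∑ j, m (i, j) := by
    intro i
    rw [← h, Finsupp.weight_apply, Finsupp.sum_fintype _ _ (by simp), Finset.sum_apply,
      Fintype.sum_prod_type, Finset.sum_eq_single i]
    · simp
    · intro b _ hb
      simp [Pi.single_eq_of_ne hb.symm]
    · simp
  have : ∏ p : ι × Fin 4, c p.1 ^ m p = ∏ i, c i ^ d i := by
    rw [Fintype.prod_prod_type]
    refine Finset.prod_congr rfl fun i _ => ?_
    rw [hd i, ← Finset.prod_pow_eq_pow_sum]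
  simp only [mul_pow, Finset.prod_mul_distrib, this]
  ring

theorem vanishesAt_iff [Fintype ι] {F : MvPolynomial (ι × Fin 4) K}
    {d : ι → ℕ} (hF : IsMultihomogeneous F d) (v : ι → Fin 4 → K) (hv : ∀ i, v i ≠ 0) :
    VanishesAt F (fun i => Projectivization.mk K (v i) (hv i)) ↔
      MvPolynomial.eval (fun p : ι × Fin 4 => v p.1 p.2) F = 0 := by
  choose c hc using fun i => Projectivization.exists_smul_eq_mk_rep K (v i) (hv i)
  unfold VanishesAt
  have : (fun p : ι × Fin 4 => (Projectivization.mk K (v p.1) (hv p.1)).rep p.2) =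
      fun p => (fun i => (c i : K)) p.1 * v p.1 p.2 := by
    funext p
    rw [← hc p.1]
    rfl
  rw [this, eval_smul_of_isMultihomogeneous hF (fun i => (c i : K)) v, mul_eq_zero,
    or_iff_right (Finset.prod_ne_zero_iff.mpr fun i _ => pow_ne_zero _ (c i).ne_zero)]

/-- A Zariski-closed subset of `(ℙ³)^ι`: the common zero set of a set of multihomogeneous
polynomials. -/
def IsZariskiClosed (Z : Set (ι → P3 K)) : Prop :=
  ∃ S : Set (MvPolynomial (ι × Fin 4) K),
    (∀ F ∈ S, ∃ d, IsMultihomogeneous F d) ∧ Z = {P | ∀ F ∈ S, VanishesAt F P}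

/-- A Zariski-open subset of `(ℙ³)^ι`. -/
def IsZariskiOpen (U : Set (ι → P3 K)) : Prop := IsZariskiClosed Uᶜ

/-- The Zariski closure of a subset of `(ℙ³)^ι`. -/
def zariskiClosure (Z : Set (ι → P3 K)) : Set (ι → P3 K) :=
  ⋂₀ {C | IsZariskiClosed C ∧ Z ⊆ C}

/-- A property holds for two generic ordered `n`-tuples of points of `ℙ³` if it holds for all
pairs of `n`-tuples in some nonempty Zariski-open subset of `(ℙ³)ⁿ × (ℙ³)ⁿ`. -/
def HoldsForGenericPair (n : ℕ) (p : (Fin n → P3 K) → (Fin n → P3 K) → Prop) : Prop :=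
  ∃ U : Set (Fin n ⊕ Fin n → P3 K), IsZariskiOpen U ∧ U.Nonempty ∧
    ∀ X Y : Fin n → P3 K, Sum.elim X Y ∈ U → p X Y

end Zariski

/-- A projective camera `ℙ³ ⇢ ℙ²`, given by a `3 × 4` matrix of rank three. -/
structure Camera (K : Type*) [Field K] where
  mat : Matrix (Fin 3) (Fin 4) K
  rank_mat : mat.rank = 3

section Cameras

variable {K : Type*} [Field K]

/-- The point `a` is the center of the camera `A`, that is, `A a = 0`. -/
def Camera.IsCenter (A : Camera K) (a : P3 K) : Prop :=
  A.mat.mulVec a.rep = 0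

/-- The image `A x ∈ ℙ²` of a world point `x` that is not the center of `A`. -/
noncomputable def Camera.image (A : Camera K) (x : P3 K) (hx : ¬ A.IsCenter x) : P2 K :=
  Projectivization.mk K (A.mat.mulVec x.rep) hx

/-- `(A x_i)_i ∼ (B y_i)_i`: both images are well-defined, and there is `H ∈ SL(3)` such that
`A x_i = H B y_i` in `ℙ²` for all `i`. -/
def ImagesEquivalent {n : ℕ} (A B : Camera K) (X Y : Fin n → P3 K) : Prop :=
  ∃ (hX : ∀ i, ¬ A.IsCenter (X i)) (hY : ∀ i, ¬ B.IsCenter (Y i))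
    (H : Matrix.SpecialLinearGroup (Fin 3) K),
    ∀ i, A.image (X i) (hX i) = H • B.image (Y i) (hY i)

/-- The locus of pairs `(a, b)` of centers of cameras `A`, `B` with
`(A x_i)_i ∼ (B y_i)_i`. -/
def centersLocus {n : ℕ} (X Y : Fin n → P3 K) : Set (P3 K × P3 K) :=
  {q | ∃ A B : Camera K, A.IsCenter q.1 ∧ B.IsCenter q.2 ∧ ImagesEquivalent A B X Y}

/-- The centers-variety: the Zariski closure of the locus of centers in `ℙ³ × ℙ³`. -/
def centersVariety {n : ℕ} (X Y : Fin n → P3 K) : Set (P3 K × P3 K) :=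
  {q | ![q.1, q.2] ∈ zariskiClosure
    ((fun r : P3 K × P3 K => (![r.1, r.2] : Fin 2 → P3 K)) '' centersLocus X Y)}

end Cameras

/-!
The proof is a parameter count, carried out on affine cones. Write a pair of `n`-tuples of points
of `ℙ³` as `8n` homogeneous coordinates.

If `(A xᵢ) ∼ (B yᵢ)`, then `A xᵢ = lᵢ H B yᵢ` with `lᵢ ≠ 0`. Let `a` be the center of `A` and
choose `p` with `a p ≠ 0`. Deleting column `p` of `A` leaves an invertible `3 × 3` matrix, and
solving for the coordinates of `xᵢ` other than the `p`-th one gives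
`xᵢ (p.succAbove j) = lᵢ (M yᵢ) j + xᵢ p * u j` with a `3 × 4` matrix `M` and a vector `u` in `K³`
that do not depend on `i` (`ImagesEquivalent.exists_mem_cameraChart`). So the pair lies in the image
of a polynomial map whose parameters are `u`, `M`, the vectors `yᵢ`, the factors `lᵢ` and the
coordinates `xᵢ p`, which are `15 + 6n < 8n` parameters in all when `n ≥ 8`.

Since a polynomial ring in `m` variables has transcendence degree `m`, the coordinates of that map
are algebraically dependent, so some nonzero polynomial vanishes on the image
(`exists_ne_zero_aeval_eq_zero`). The locus `cameraChart` is stable under rescaling each point, so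
each multihomogeneous component of this polynomial vanishes on it as well
(`exists_isMultihomogeneous_of_smul_mem`). The product over the four choices of `p` is a nonzero
multihomogeneous polynomial, and its non-vanishing locus is the required open set.
-/

/-! ### Polynomials vanishing on cones -/

/-- A polynomial map to an affine space of larger dimension satisfies a nontrivial polynomial
relation. -/
theorem exists_ne_zero_aeval_eq_zero {K σ τ : Type*} [Field K] [Fintype σ] [Fintype τ]
    (h : Fintype.card σ < Fintype.card τ) (g : τ → MvPolynomial σ K) :
    ∃ F : MvPolynomial τ K, F ≠ 0 ∧ MvPolynomial.aeval g F = 0 := by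
  by_contra! hF
  have hg : AlgebraicIndependent K g := by
    rw [algebraicIndependent_iff]
    intro F h0
    by_contra hne
    exact hF F hne h0
  have := hg.lift_cardinalMk_le_trdeg
  rw [MvPolynomial.trdeg_of_isDomain, Cardinal.mk_fintype, Cardinal.mk_fintype] at this
  simp only [Cardinal.lift_natCast, Nat.cast_le] at this
  omega

theorem eval_aeval {K σ τ : Type*} [CommRing K] (t : σ → K) (g : τ → MvPolynomial σ K)
    (F : MvPolynomial τ K) :
    MvPolynomial.eval t (MvPolynomial.aeval g F) =
      MvPolynomial.eval (fun q => MvPolynomial.eval t (g q)) F := by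
  induction F using MvPolynomial.induction_on with
  | C a => simp
  | add F G hF hG => simp only [map_add, hF, hG]
  | mul_X F q hF => simp only [map_mul, hF, MvPolynomial.aeval_X, MvPolynomial.eval_X]

section Cones

variable {K : Type*} [Field K] {ι : Type*} [Fintype ι] [DecidableEq ι]

/-- Substituting `c i * v i j` for `x_{i,j}` turns `F` into a polynomial in the scaling factors
`c i`, whose coefficients are the values at `v` of the multihomogeneous components of `F`. -/
theorem coeff_aeval_C_mul_X (v : ι → Fin 4 → K) (F : MvPolynomial (ι × Fin 4) K) (d : ι →₀ ℕ) :
    (MvPolynomial.aeval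
      (fun q : ι × Fin 4 => MvPolynomial.C (v q.1 q.2) * MvPolynomial.X (R := K) q.1) F).coeff d =
    MvPolynomial.eval (fun q => v q.1 q.2) (MvPolynomial.weightedHomogeneousComponent
      (fun q : ι × Fin 4 => (Pi.single q.1 1 : ι → ℕ)) d F) := by
  induction F using MvPolynomial.induction_on' with
  | add F G hF hG => simp only [map_add, MvPolynomial.coeff_add, hF, hG]
  | monomial m r =>
    have hw : Finsupp.weight (fun q : ι × Fin 4 => (Pi.single q.1 1 : ι → ℕ)) m =
        fun i => ∑ j, m (i, j) := by
      funext i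
      rw [Finsupp.weight_apply, Finsupp.sum_fintype _ _ (by simp), Finset.sum_apply,
        Fintype.sum_prod_type, Finset.sum_eq_single i]
      · simp
      · intro b _ hb
        simp [Pi.single_eq_of_ne hb.symm]
      · simp
    have hL : MvPolynomial.aeval
        (fun q : ι × Fin 4 => MvPolynomial.C (v q.1 q.2) * MvPolynomial.X (R := K) q.1)
        (MvPolynomial.monomial m r) =
        MvPolynomial.monomial (Finsupp.equivFunOnFinite.symm fun i => ∑ j, m (i, j))
          (r * ∏ q, v q.1 q.2 ^ m q) := by
      rw [MvPolynomial.aeval_monomial, Finsupp.prod_fintype _ _ (by simp),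
        MvPolynomial.monomial_eq, Finsupp.prod_fintype _ _ (by simp)]
      simp only [mul_pow, Finset.prod_mul_distrib, Fintype.prod_prod_type, Finset.prod_pow_eq_pow_sum,
        map_mul, map_prod, map_pow, MvPolynomial.algebraMap_eq, mul_assoc,
        Finsupp.coe_equivFunOnFinite_symm]
    rw [hL, MvPolynomial.coeff_monomial]
    by_cases hd : (fun i => ∑ j, m (i, j)) = (d : ι → ℕ)
    · rw [if_pos (by ext i; simpa using congrFun hd i),
        MvPolynomial.IsWeightedHomogeneous.weightedHomogeneousComponent_same
          (MvPolynomial.isWeightedHomogeneous_monomial _ _ _ (hw.trans hd)),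
        MvPolynomial.eval_monomial, Finsupp.prod_fintype _ _ (by simp)]
    · rw [if_neg (fun h => hd (by rw [← h]; simp)),
        MvPolynomial.IsWeightedHomogeneous.weightedHomogeneousComponent_ne _
          (MvPolynomial.isWeightedHomogeneous_monomial _ _ _ hw) (fun h => hd h.symm), map_zero]

/-- If a nonzero polynomial vanishes on a set of tuples of vectors that is stable under rescaling
each vector, then so does a nonzero multihomogeneous polynomial. -/
theorem exists_isMultihomogeneous_of_smul_mem [Infinite K] {T : Set (ι → Fin 4 → K)}
    (hT : ∀ v ∈ T, ∀ c : ι → K, (∀ i, c i ≠ 0) → (fun i j => c i * v i j) ∈ T)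
    {F : MvPolynomial (ι × Fin 4) K} (hF : F ≠ 0)
    (hFT : ∀ v ∈ T, MvPolynomial.eval (fun q => v q.1 q.2) F = 0) :
    ∃ (G : MvPolynomial (ι × Fin 4) K) (d : ι → ℕ), G ≠ 0 ∧ IsMultihomogeneous G d ∧
      ∀ v ∈ T, MvPolynomial.eval (fun q => v q.1 q.2) G = 0 := by
  obtain ⟨m, hm⟩ := MvPolynomial.ne_zero_iff.mp hF
  set w : ι × Fin 4 → ι → ℕ := fun q => Pi.single q.1 1 with hw
  refine ⟨MvPolynomial.weightedHomogeneousComponent w (Finsupp.weight w m) F, Finsupp.weight w m,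
    ?_, MvPolynomial.weightedHomogeneousComponent_isWeightedHomogeneous _ _, fun v hv => ?_⟩
  · refine MvPolynomial.ne_zero_iff.mpr ⟨m, ?_⟩
    rwa [MvPolynomial.coeff_weightedHomogeneousComponent, if_pos rfl]
  · have key := coeff_aeval_C_mul_X v F (Finsupp.equivFunOnFinite.symm (Finsupp.weight w m))
    rw [Finsupp.coe_equivFunOnFinite_symm] at key
    rw [← key]
    set P := MvPolynomial.aeval
      (fun q : ι × Fin 4 => MvPolynomial.C (v q.1 q.2) * MvPolynomial.X (R := K) q.1) F with hP
    -- `T` is only stable under nonzero factors, so `P` is first multiplied by the product of all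
    -- variables.
    have h0 : P * ∏ i, MvPolynomial.X i = 0 := by
      refine MvPolynomial.funext fun c => ?_
      rw [map_mul, map_prod, map_zero]
      by_cases hc : ∀ i, c i ≠ 0
      · have hPc : MvPolynomial.eval c P =
            MvPolynomial.eval (fun q : ι × Fin 4 => c q.1 * v q.1 q.2) F := by
          rw [hP, eval_aeval]
          simp only [map_mul, MvPolynomial.eval_C, MvPolynomial.eval_X, mul_comm]
        rw [hPc, hFT _ (hT v hv c hc), zero_mul]
      · push Not at hc
        obtain ⟨i, hi⟩ := hc
        rw [Finset.prod_eq_zero (Finset.mem_univ i) (by simpa using hi), mul_zero]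
    have hP0 : P = 0 := (mul_eq_zero.mp h0).resolve_right
      (Finset.prod_ne_zero_iff.mpr fun i _ => MvPolynomial.X_ne_zero i)
    rw [hP0, MvPolynomial.coeff_zero]

/-! ### Zariski-open and Zariski-closed sets -/

/-- The non-vanishing locus of a nonzero multihomogeneous polynomial on `(ℙ³)^ι` is nonempty. -/
theorem exists_not_vanishesAt [Infinite K] {F : MvPolynomial (ι × Fin 4) K} (hF : F ≠ 0)
    {d : ι → ℕ} (hd : IsMultihomogeneous F d) : ∃ P : ι → P3 K, ¬ VanishesAt F P := by
  -- Multiplying by the variables `x_{i,0}` forces every vector of a point of non-vanishing to be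
  -- nonzero.
  have hne : F * ∏ i, MvPolynomial.X (i, 0) ≠ 0 :=
    mul_ne_zero hF (Finset.prod_ne_zero_iff.mpr fun i _ => MvPolynomial.X_ne_zero _)
  obtain ⟨x, hx⟩ : ∃ x, MvPolynomial.eval x (F * ∏ i, MvPolynomial.X (i, 0)) ≠ 0 := by
    by_contra! h
    exact hne (MvPolynomial.funext fun x => by rw [h x, map_zero])
  rw [map_mul, map_prod, mul_ne_zero_iff, Finset.prod_ne_zero_iff] at hx
  have hv : ∀ i, (fun j => x (i, j)) ≠ 0 := fun i h0 =>
    hx.2 i (Finset.mem_univ i) (by rw [MvPolynomial.eval_X]; exact congrFun h0 0)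
  exact ⟨fun i => Projectivization.mk K _ (hv i), fun h =>
    hx.1 ((vanishesAt_iff hd (fun i j => x (i, j)) hv).mp h)⟩

end Cones

section ZariskiTopology

variable {K : Type*} [Field K] {ι : Type*} [DecidableEq ι]

theorem isZariskiOpen_setOf_not_vanishesAt {F : MvPolynomial (ι × Fin 4) K} {d : ι → ℕ}
    (hd : IsMultihomogeneous F d) : IsZariskiOpen {P : ι → P3 K | ¬ VanishesAt F P} :=
  ⟨{F}, by rintro _ rfl; exact ⟨d, hd⟩, by ext P; simp⟩

theorem zariskiClosure_empty : zariskiClosure (∅ : Set (ι → P3 K)) = ∅ := by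
  refine Set.sInter_eq_empty_iff.mpr fun P => ⟨∅, ⟨⟨{1}, ?_, ?_⟩, subset_rfl⟩, id⟩
  · rintro _ rfl
    exact ⟨0, MvPolynomial.isWeightedHomogeneous_one _ _⟩
  · ext P
    simp [VanishesAt]

end ZariskiTopology

/-! ### Cameras -/

section CameraCharts

variable {K : Type*} [Field K]

/-- A camera matrix has a nonzero kernel vector `a` with a coordinate `a p ≠ 0` such that the matrix
stays invertible when column `p` is deleted. -/
theorem Camera.exists_kernel_vector (A : Camera K) :
    ∃ (a : Fin 4 → K) (p : Fin 4), A.mat.mulVec a = 0 ∧ a p ≠ 0 ∧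
      IsUnit (A.mat.submatrix id p.succAbove) := by
  have hker : Module.finrank K (LinearMap.ker A.mat.mulVecLin) = 1 := by
    have := LinearMap.finrank_range_add_finrank_ker A.mat.mulVecLin
    have hr : Module.finrank K (LinearMap.range A.mat.mulVecLin) = 3 := A.rank_mat
    rw [hr, Module.finrank_fintype_fun_eq_card, Fintype.card_fin] at this
    omega
  obtain ⟨⟨a, ha⟩, ha0, hspan⟩ := finrank_eq_one_iff'.mp hker
  have ha' : a ≠ 0 := fun h => ha0 (Subtype.ext h)
  obtain ⟨p, hp⟩ := Function.ne_iff.mp ha'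
  refine ⟨a, p, by simpa using ha, hp, ?_⟩
  rw [← Matrix.mulVec_injective_iff_isUnit, ← Matrix.coe_mulVecLin, ← LinearMap.ker_eq_bot,
    LinearMap.ker_eq_bot']
  intro z hz
  have hmem : p.insertNth 0 z ∈ LinearMap.ker A.mat.mulVecLin := by
    rw [LinearMap.mem_ker, Matrix.mulVecLin_apply, ← hz, Matrix.mulVecLin_apply]
    funext k
    simp [Matrix.mulVec, dotProduct, Fin.sum_univ_succAbove _ p]
  obtain ⟨c, hc⟩ := hspan ⟨_, hmem⟩
  have hc : ∀ j, c * a j = (p.insertNth 0 z : Fin 4 → K) j := fun j =>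
    congrFun (congrArg Subtype.val hc) j
  have hc0 : c = 0 := by
    have := hc p
    rw [Fin.insertNth_apply_same] at this
    exact (mul_eq_zero.mp this).resolve_right hp
  funext j
  have := hc (p.succAbove j)
  rw [Fin.insertNth_apply_succAbove, hc0, zero_mul] at this
  exact this.symm

/-- The pairs of `n`-tuples of vectors `(xᵢ)`, `(yᵢ)` in `K⁴`, encoded as one family over
`Fin n ⊕ Fin n`, for which there are a vector `u` and a matrix `M` such that, for every `i`,
`xᵢ (p.succAbove j) = l (M yᵢ) j + xᵢ p * u j` with some `l ≠ 0`. Here `u` consists of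
the remaining coordinates of the center of the first camera, scaled to have coordinate `p` equal
to `1`. -/
def cameraChart (K : Type*) [Field K] (n : ℕ) (p : Fin 4) : Set (Fin n ⊕ Fin n → Fin 4 → K) :=
  {v | ∃ (u : Fin 3 → K) (M : Matrix (Fin 3) (Fin 4) K), ∀ i, ∃ l : K, l ≠ 0 ∧
    ∀ j, v (Sum.inl i) (p.succAbove j) =
      l * M.mulVec (v (Sum.inr i)) j + v (Sum.inl i) p * u j}

theorem smul_mem_cameraChart {n : ℕ} {p : Fin 4} {v : Fin n ⊕ Fin n → Fin 4 → K}
    (hv : v ∈ cameraChart K n p) (c : Fin n ⊕ Fin n → K) (hc : ∀ i, c i ≠ 0) :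
    (fun i j => c i * v i j) ∈ cameraChart K n p := by
  obtain ⟨u, M, h⟩ := hv
  refine ⟨u, M, fun i => ?_⟩
  obtain ⟨l, hl, h⟩ := h i
  refine ⟨c (Sum.inl i) * l / c (Sum.inr i), div_ne_zero (mul_ne_zero (hc _) hl) (hc _),
    fun j => ?_⟩
  have hs : M.mulVec (fun j => c (Sum.inr i) * v (Sum.inr i) j) =
      c (Sum.inr i) • M.mulVec (v (Sum.inr i)) := M.mulVec_smul (c (Sum.inr i)) (v (Sum.inr i))
  beta_reduce
  rw [h j, hs, Pi.smul_apply, smul_eq_mul]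
  have := hc (Sum.inr i)
  field_simp

theorem ImagesEquivalent.exists_mem_cameraChart {n : ℕ} {A B : Camera K} {X Y : Fin n → P3 K}
    (h : ImagesEquivalent A B X Y) :
    ∃ p, (fun i => (Sum.elim X Y i).rep) ∈ cameraChart K n p := by
  obtain ⟨hX, hY, H, h⟩ := h
  obtain ⟨a, p, ha, hp, hA⟩ := A.exists_kernel_vector
  set A' := A.mat.submatrix id p.succAbove with hA'
  refine ⟨p, fun j => a (p.succAbove j) / a p, A'⁻¹ * H.1 * B.mat, fun i => ?_⟩
  obtain ⟨l, hl⟩ : ∃ l : Kˣ, (l : K) • (H.1.mulVec (B.mat.mulVec (Y i).rep)) =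
      A.mat.mulVec (X i).rep := by
    have hi := h i
    obtain ⟨l, hl⟩ := (Projectivization.mk_eq_mk_iff K _ _ _ _).mp hi
    exact ⟨l, hl⟩
  refine ⟨l, l.ne_zero, fun j => ?_⟩
  set x := (X i).rep with hx
  -- Subtracting a multiple of the center, `A x` becomes `A'` applied to a vector of `K³`.
  have key : A'.mulVec (fun j => x (p.succAbove j) - x p * (a (p.succAbove j) / a p)) =
      A.mat.mulVec x := by
    have h1 : A.mat.mulVec (x - (x p / a p) • a) = A.mat.mulVec x := by
      rw [Matrix.mulVec_sub, Matrix.mulVec_smul, ha, smul_zero, sub_zero]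
    rw [← h1]
    funext k
    simp only [Matrix.mulVec, dotProduct, Fin.sum_univ_succAbove _ p, hA', Matrix.submatrix_apply,
      id, Pi.sub_apply, Pi.smul_apply, smul_eq_mul, div_mul_cancel₀ _ hp, sub_self, mul_zero,
      zero_add]
    exact Finset.sum_congr rfl fun j _ => by ring
  have hdet := (Matrix.isUnit_iff_isUnit_det _).mp hA
  have h2 := congrArg (A'⁻¹.mulVec) (key.trans hl.symm)
  rw [Matrix.mulVec_mulVec, Matrix.nonsing_inv_mul _ hdet, Matrix.one_mulVec, Matrix.mulVec_smul,
    Matrix.mulVec_mulVec, Matrix.mulVec_mulVec] at h2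
  have h3 := congrFun h2 j
  rw [Pi.smul_apply, smul_eq_mul] at h3
  exact sub_eq_iff_eq_add.mp h3

/-- The parameters of the points of `cameraChart`: the vector `u`, the matrix `M`, the pairs
`(l, xᵢ p)` and the vectors `yᵢ`. -/
abbrev ChartParam (n : ℕ) := Fin 3 ⊕ (Fin 3 × Fin 4) ⊕ (Fin n × Fin 2) ⊕ (Fin n × Fin 4)

/-- A polynomial map whose image contains `cameraChart`, where `inr (inr (inl (i, 0)))`
is the factor `l` of index `i` and `inr (inr (inl (i, 1)))` is the coordinate `xᵢ p`. -/
noncomputable def chartMap (K : Type*) [Field K] (n : ℕ) (p : Fin 4) :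
    (Fin n ⊕ Fin n) × Fin 4 → MvPolynomial (ChartParam n) K
  | (Sum.inl i, k) => p.insertNth (α := fun _ => MvPolynomial (ChartParam n) K)
      (MvPolynomial.X (Sum.inr (Sum.inr (Sum.inl (i, 1)))))
      (fun j => MvPolynomial.X (Sum.inr (Sum.inr (Sum.inl (i, 0)))) *
          ∑ k, MvPolynomial.X (Sum.inr (Sum.inl (j, k))) *
            MvPolynomial.X (Sum.inr (Sum.inr (Sum.inr (i, k)))) +
        MvPolynomial.X (Sum.inr (Sum.inr (Sum.inl (i, 1)))) * MvPolynomial.X (Sum.inl j)) k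
  | (Sum.inr i, k) => MvPolynomial.X (Sum.inr (Sum.inr (Sum.inr (i, k))))

theorem exists_eval_chartMap {n : ℕ} {p : Fin 4} {v : Fin n ⊕ Fin n → Fin 4 → K}
    (hv : v ∈ cameraChart K n p) :
    ∃ t : ChartParam n → K, ∀ q, MvPolynomial.eval t (chartMap K n p q) = v q.1 q.2 := by
  obtain ⟨u, M, h⟩ := hv
  choose l _ h using h
  refine ⟨Sum.elim u (Sum.elim (fun q => M q.1 q.2)
    (Sum.elim (fun q => if q.2 = 0 then l q.1 else v (Sum.inl q.1) p)
      fun q => v (Sum.inr q.1) q.2)), ?_⟩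
  rintro ⟨i | i, k⟩
  · refine Fin.succAboveCases p ?_ (fun j => ?_) k
    · simp [chartMap]
    · simp [chartMap, h, Matrix.mulVec, dotProduct]
  · simp [chartMap]

theorem exists_isMultihomogeneous_cameraChart [Infinite K] {n : ℕ} (hn : 8 ≤ n) (p : Fin 4) :
    ∃ (F : MvPolynomial ((Fin n ⊕ Fin n) × Fin 4) K) (d : Fin n ⊕ Fin n → ℕ), F ≠ 0 ∧
      IsMultihomogeneous F d ∧
      ∀ v ∈ cameraChart K n p, MvPolynomial.eval (fun q => v q.1 q.2) F = 0 := by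
  obtain ⟨F, hF, hF0⟩ := exists_ne_zero_aeval_eq_zero (by simp; omega) (chartMap K n p)
  refine exists_isMultihomogeneous_of_smul_mem (fun v hv => smul_mem_cameraChart hv) hF
    fun v hv => ?_
  obtain ⟨t, ht⟩ := exists_eval_chartMap hv
  have := congrArg (MvPolynomial.eval t) hF0
  rwa [map_zero, eval_aeval, funext ht] at this

end CameraCharts

theorem mainTheorem6 (K : Type*) [RCLike K] (n : ℕ) (hn : 8 ≤ n) :
    HoldsForGenericPair n (fun X Y : Fin n → P3 K =>
      (¬ ∃ A B : Camera K, ImagesEquivalent A B X Y) ∧ centersVariety X Y = ∅) := by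
  choose F d hF hd hv using exists_isMultihomogeneous_cameraChart (K := K) hn
  have hne : ∏ p, F p ≠ 0 := Finset.prod_ne_zero_iff.mpr fun p _ => hF p
  have hhom : IsMultihomogeneous (∏ p, F p) (∑ p, d p) :=
    MvPolynomial.IsWeightedHomogeneous.prod _ _ _ fun p _ => hd p
  refine ⟨{P | ¬ VanishesAt (∏ p, F p) P}, isZariskiOpen_setOf_not_vanishesAt hhom, exists_not_vanishesAt hne hhom,
    fun X Y hXY => ?_⟩
  have hno : ¬ ∃ A B : Camera K, ImagesEquivalent A B X Y := by
    rintro ⟨A, B, h⟩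
    obtain ⟨p, hp⟩ := h.exists_mem_cameraChart
    have hFp := hv p _ hp
    apply hXY
    unfold VanishesAt
    rw [map_prod]
    exact Finset.prod_eq_zero (Finset.mem_univ p) hFp
  refine ⟨hno, ?_⟩
  have hlocus : centersLocus X Y = ∅ :=
    Set.eq_empty_of_forall_notMem fun q ⟨A, B, _, _, h⟩ => hno ⟨A, B, h⟩
  rw [centersVariety, hlocus, Set.image_empty, zariskiClosure_empty]
  rfl
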